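/- Let $F_2$ be the free group on two generators. For a discrete group $\Gamma$, a $\Gamma$-flow is a nonempty compact metrizable space $X$ on which $\Gamma$ acts by homeomorphisms; it is free if $\gamma x\neq x$ for all $\gamma\in\Gamma\setminus\{1\}$ and all $x\in X$, and minimal if every orbit is dense. $\mathrm{Aut}(X,\Gamma)$ denotes the group of homeomorphisms of $X$ which commute with the $\Gamma$-action, and a characteristic measure of the $\Gamma$-flow $X$ is a Borel probability measure on $X$ which is invariant under $\mathrm{Aut}(X,\Gamma)$. Theorem. For every countably infinite group $G$ there is a free minimal $G$-flow $X$ which does not admit a characteristic measure. More precisely, there is a free $(G\times F_2)$-flow $X$ which, as a $G$-flow (via $g\mapsto (g,1)$), is minimal and has no characteristic measure, and which has no $F_2$-invariant Borel probability measure (where $F_2$ acts via $h\mapsto(1,h)$). -/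

import Mathlib

universe u

open MeasureTheory

/-- `X` with the given action is a `G`-flow, for a discrete group `G`: a nonempty compact
metrizable space (metrizable spaces are Hausdorff) on which each element of `G` acts
continuously, hence by a homeomorphism. -/
structure IsFlow (G X : Type*) [Group G] [TopologicalSpace X] [MulAction G X] : Prop where
  nonempty : Nonempty X
  compact : CompactSpace X
  metrizable : TopologicalSpace.MetrizableSpace X
  continuous_smul : ∀ g : G, Continuous fun x : X => g • x

/-- No element other than the identity fixes a point. -/
def IsFreeAction (G X : Type*) [Group G] [MulAction G X] : Prop :=
  ∀ g : G, g ≠ 1 → ∀ x : X, g • x ≠ x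

/-- `Aut(X, G)`: the group of homeomorphisms of `X` which commute with the action of `G`. -/
def flowAut (G X : Type*) [Group G] [TopologicalSpace X] [MulAction G X] :
    Subgroup (X ≃ₜ X) where
  carrier := {f | ∀ (g : G) (x : X), f (g • x) = g • f x}
  mul_mem' := by
    intro a b ha hb g x
    change a (b (g • x)) = g • a (b x)
    rw [hb, ha]
  one_mem' := fun _ _ => rfl
  inv_mem' := by
    intro a ha g x
    change a.symm (g • x) = g • a.symm x
    apply a.injective
    rw [ha, a.apply_symm_apply, a.apply_symm_apply]

/-- A characteristic measure of the `G`-flow `X`: a Borel probability measure invariant under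
every element of `Aut(X, G)`. -/
def IsCharacteristicMeasure (G : Type*) {X : Type*} [Group G] [TopologicalSpace X]
    [MulAction G X] [MeasurableSpace X] (μ : Measure X) : Prop :=
  IsProbabilityMeasure μ ∧ ∀ f ∈ flowAut G X, μ.map f = μ

/-! The `F₂`-action commutes with `G`, so a characteristic measure of the `G`-flow would be
`F₂`-invariant. It suffices to find a free flow of the product on which `G` is minimal and which
maps `F₂`-equivariantly to a flow without invariant probability measure.

The obstruction to invariant measures is the nonamenability of `F₂`. Its Cayley graph carries an
edge function pointing away from the identity, with divergence at least 2 everywhere, while an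
invariant measure forces mean divergence 0. Points of `FlowFamily.bounded` are sequences of edge
functions whose deficits from divergence 1 sum to at most 1 at each vertex, so the first two have
divergences summing to at least 1 (`not_map_eq_of_equivariant`). Sequences leave flexibility:
averaging over blocks of length `m` divides the deficit bound by `m`, which makes room to splice in
any prescribed pattern (`exists_equivariant_mem`). With a profinite factor added for freeness, this
gives a flow `Y` whose endomorphisms move any point into any nonempty open set
(`exists_freeTwo_flow`).

To make `G` minimal, take `Z × Y^G` with `Z` a free minimal zero-dimensional `G`-flow. Around visits
of the `Z`-coordinate to a small clopen set, an endomorphism writes several candidate patterns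
obtained from endomorphisms of `Y`; by compactness finitely many candidates suffice for one to hit
the target (`exists_equivariant_forall_exists_smul_mem`). Composing such endomorphisms infinitely
often and intersecting the images gives the required subflow. -/

/-! ### Minimal subflows from endomorphisms and from Zorn's lemma -/

/-- If every nonempty open set can be hit, using only elements of `S`, from each point of the
image of some equivariant continuous self-map, then there is a nonempty closed invariant subset
in which every `S`-orbit is dense. -/
theorem exists_subMulAction_minimal_of_endomorphisms {Γ Ω : Type*} [Group Γ] [TopologicalSpace Ω]
    [CompactSpace Ω] [T2Space Ω] [SecondCountableTopology Ω] [Nonempty Ω] [MulAction Γ Ω]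
    (S : Set Γ)
    (h : ∀ U : Set Ω, IsOpen U → U.Nonempty → ∃ φ : Ω → Ω, Continuous φ ∧
      (∀ (γ : Γ) x, φ (γ • x) = γ • φ x) ∧ ∀ x, ∃ g ∈ S, g • φ x ∈ U) :
    ∃ X : SubMulAction Γ Ω, IsClosed (X : Set Ω) ∧ (X : Set Ω).Nonempty ∧
      ∀ x ∈ X, ∀ U : Set Ω, IsOpen U → (U ∩ X).Nonempty → ∃ g ∈ S, g • x ∈ U := by
  obtain ⟨B, hB⟩ := TopologicalSpace.exists_countable_basis Ω
  obtain ⟨hBc, -, hBb⟩ := hB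
  have hBne : B.Nonempty := by
    by_contra hcon
    obtain ⟨x⟩ := ‹Nonempty Ω›
    obtain ⟨v, hv, -⟩ := hBb.exists_subset_of_mem_open (Set.mem_univ x) isOpen_univ
    exact hcon ⟨v, hv⟩
  obtain ⟨b, rfl⟩ := hBc.exists_eq_range hBne
  let E := {φ : Ω → Ω // Continuous φ ∧ ∀ (γ : Γ) x, φ (γ • x) = γ • φ x}
  -- The hypothesis is applied to the pullback of `b n`, so that precomposing with `φ` treats `b n`
  -- and keeps the images decreasing. If the pullback is empty, `b n` misses the final set and the
  -- identity will do.
  have step : ∀ (n : ℕ) (Φ : E), ∃ φ : E, (Φ.1 ⁻¹' (b n)).Nonempty →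
      ∀ x, ∃ g ∈ S, g • φ.1 x ∈ Φ.1 ⁻¹' (b n) := by
    intro n Φ
    by_cases hne : (Φ.1 ⁻¹' (b n)).Nonempty
    · obtain ⟨φ, h1, h2, h3⟩ := h _ ((hBb.isOpen ⟨n, rfl⟩).preimage Φ.2.1) hne
      exact ⟨⟨φ, h1, h2⟩, fun _ => h3⟩
    · exact ⟨⟨id, continuous_id, fun _ _ => rfl⟩, fun h => absurd h hne⟩
  choose φ hφ using step
  let Φ : ℕ → E := fun n => Nat.rec ⟨id, continuous_id, fun _ _ => rfl⟩
    (fun n Ψ => ⟨Ψ.1 ∘ (φ n Ψ).1, Ψ.2.1.comp (φ n Ψ).2.1, fun γ x => by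
      simp [(φ n Ψ).2.2, Ψ.2.2]⟩) n
  have hΦ : ∀ n, (Φ (n + 1)).1 = (Φ n).1 ∘ (φ n (Φ n)).1 := fun n => rfl
  have hcomp : ∀ n, IsCompact (Set.range (Φ n).1) := fun n => isCompact_range (Φ n).2.1
  refine ⟨⟨⋂ n, Set.range (Φ n).1, ?_⟩, ?_, ?_, ?_⟩
  · intro γ x hx
    rw [Set.mem_iInter] at hx ⊢
    intro n
    obtain ⟨y, rfl⟩ := hx n
    exact ⟨γ • y, (Φ n).2.2 γ y⟩
  · exact isClosed_iInter fun n => (hcomp n).isClosed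
  · apply IsCompact.nonempty_iInter_of_sequence_nonempty_isCompact_isClosed
    · intro n
      rw [hΦ]
      exact Set.range_comp_subset_range _ _
    · exact fun n => Set.range_nonempty _
    · exact hcomp 0
    · exact fun n => (hcomp n).isClosed
  · intro x hx U hU ⟨u, huU, huX⟩
    obtain ⟨_, ⟨n, rfl⟩, hun, hnU⟩ := hBb.exists_subset_of_mem_open huU hU
    have huX' : u ∈ ⋂ n, Set.range (Φ n).1 := huX
    have hx' : x ∈ ⋂ n, Set.range (Φ n).1 := hx
    rw [Set.mem_iInter] at huX' hx'
    obtain ⟨v, rfl⟩ := huX' n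
    obtain ⟨w, rfl⟩ := hx' (n + 1)
    obtain ⟨g, hg, hgw⟩ := hφ n (Φ n) ⟨v, hun⟩ w
    refine ⟨g, hg, hnU ?_⟩
    rw [hΦ, Function.comp_apply, ← (Φ n).2.2]
    exact hgw

/-- In a compact space with a continuous action there is a nonempty closed invariant subset
on which the action is minimal. -/
theorem exists_subMulAction_isMinimal (G Z : Type*) [Group G] [TopologicalSpace Z]
    [CompactSpace Z] [Nonempty Z] [MulAction G Z] [ContinuousConstSMul G Z] :
    ∃ X : SubMulAction G Z, IsClosed (X : Set Z) ∧ (X : Set Z).Nonempty ∧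
      MulAction.IsMinimal G X := by
  let A : Set (Set Z) := {X | IsClosed X ∧ X.Nonempty ∧ ∀ (g : G), ∀ x ∈ X, g • x ∈ X}
  obtain ⟨M, hM⟩ : ∃ M, Minimal (· ∈ A) M := by
    obtain ⟨M, -, hM⟩ := zorn_superset_nonempty A (fun c hcA hc hne => by
      refine ⟨⋂₀ c, ⟨isClosed_sInter fun s hs => (hcA hs).1, ?_, ?_⟩,
        fun s hs => Set.sInter_subset_of_mem hs⟩
      · have : Nonempty c := hne.to_subtype
        exact IsCompact.nonempty_sInter_of_directed_nonempty_isCompact_isClosed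
          (fun a ha b hb => (hc.total ha hb).elim (fun h => ⟨a, ha, subset_rfl, h⟩)
            fun h => ⟨b, hb, h, subset_rfl⟩) (fun s hs => (hcA hs).2.1)
          (fun s hs => (hcA hs).1.isCompact) (fun s hs => (hcA hs).1)
      · intro g x hx s hs
        exact (hcA hs).2.2 g x (hx s hs)) Set.univ
        ⟨isClosed_univ, Set.univ_nonempty, fun _ _ _ => Set.mem_univ _⟩
    exact ⟨M, hM⟩
  obtain ⟨⟨hcl, hne, hinv⟩, hmin⟩ := hM
  refine ⟨⟨M, fun g {x} hx => hinv g x hx⟩, hcl, hne, ⟨fun x => ?_⟩⟩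
  have hsub : closure (MulAction.orbit G (x : Z)) ∈ A := by
    refine ⟨isClosed_closure, (MulAction.nonempty_orbit _).closure, fun g y hy => ?_⟩
    refine map_mem_closure (continuous_const_smul g) hy ?_
    rintro _ ⟨k, rfl⟩
    exact ⟨g * k, mul_smul _ _ _⟩
  have hle : closure (MulAction.orbit G (x : Z)) ≤ M := by
    apply closure_minimal _ hcl
    rintro _ ⟨k, rfl⟩
    exact hinv k _ x.2
  intro y
  have hy : (y : Z) ∈ closure (MulAction.orbit G (x : Z)) := hmin hsub hle y.2
  rw [closure_subtype]
  convert hy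
  ext w
  simp only [Set.mem_image, MulAction.mem_orbit_iff]
  constructor
  · rintro ⟨_, ⟨k, rfl⟩, rfl⟩
    exact ⟨k, rfl⟩
  · rintro ⟨k, rfl⟩
    exact ⟨k • x, ⟨k, rfl⟩, rfl⟩

/-! ### Free minimal zero-dimensional flows from colourings -/

/-- A fixed-point-free left translation of a countable group admits a proper `3`-colouring. -/
theorem exists_coloring_mul_left {G : Type*} [Group G] [Countable G] (g : G) (hg : g ≠ 1) :
    ∃ c : G → Fin 3, ∀ x, c (g * x) ≠ c x := by
  obtain ⟨e, he⟩ := exists_injective_nat G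
  -- Greedy colouring along an enumeration: only `g * x` and `g⁻¹ * x` constrain `x`, so three
  -- colours suffice; `none` marks a neighbour not yet coloured.
  have avoid : ∀ a b : Option (Fin 3), ∃ k : Fin 3, a ≠ some k ∧ b ≠ some k := by decide
  choose pick hp1 hp2 using avoid
  classical
  let R : G → G → Prop := fun x y => e x < e y
  have hwf : WellFounded R := InvImage.wf e Nat.lt_wfRel.wf
  let F : ∀ x, (∀ y, R y x → Fin 3) → Fin 3 := fun x rec =>
    pick (if h : R (g * x) x then some (rec _ h) else none)
      (if h : R (g⁻¹ * x) x then some (rec _ h) else none)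
  let c := hwf.fix F
  have hc : ∀ x, c x = pick (if R (g * x) x then some (c (g * x)) else none)
      (if R (g⁻¹ * x) x then some (c (g⁻¹ * x)) else none) := by
    intro x
    have := hwf.fix_eq F x
    simp only [F, dite_eq_ite] at this
    exact this
  refine ⟨c, fun x hx => ?_⟩
  have hne : e (g * x) ≠ e x := fun h => hg (by simpa using he h)
  rcases lt_or_gt_of_ne hne with h | h
  · have := hp1 (if R (g * x) x then some (c (g * x)) else none)
      (if R (g⁻¹ * x) x then some (c (g⁻¹ * x)) else none)
    rw [← hc, if_pos h, hx] at this
    exact this rfl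
  · have := hp2 (if R (g * (g * x)) (g * x) then some (c (g * (g * x))) else none)
      (if R (g⁻¹ * (g * x)) (g * x) then some (c (g⁻¹ * (g * x))) else none)
    rw [← hc, inv_mul_cancel_left, if_pos h, hx] at this
    exact this rfl

/-- Functions `G → G → Fin 3`, on which `G` acts by right translation of the second variable. -/
def ColoringSpace (G : Type*) := G → G → Fin 3

namespace ColoringSpace

variable (G : Type*) [Group G]

instance : TopologicalSpace (ColoringSpace G) := inferInstanceAs (TopologicalSpace (G → G → Fin 3))
instance : CompactSpace (ColoringSpace G) := inferInstanceAs (CompactSpace (G → G → Fin 3))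
instance : T2Space (ColoringSpace G) := inferInstanceAs (T2Space (G → G → Fin 3))
instance : TotallyDisconnectedSpace (ColoringSpace G) :=
  inferInstanceAs (TotallyDisconnectedSpace (G → G → Fin 3))
instance [Countable G] : SecondCountableTopology (ColoringSpace G) :=
  inferInstanceAs (SecondCountableTopology (G → G → Fin 3))

instance : MulAction G (ColoringSpace G) where
  smul h c := fun g x => c g (x * h)
  one_smul c := by funext g x; exact congrArg (c g) (mul_one x)
  mul_smul h k c := by funext g x; exact congrArg (c g) (mul_assoc x h k).symm

instance : ContinuousConstSMul G (ColoringSpace G) where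
  continuous_const_smul h := by
    refine continuous_pi fun g => continuous_pi fun x => ?_
    exact (continuous_apply (x * h)).comp (continuous_apply g)

/-- The family of all proper colourings: the `g`-th colouring separates `g * x` from `x`. -/
def proper : SubMulAction G (ColoringSpace G) where
  carrier := {c | ∀ g x : G, g ≠ 1 → c g (g * x) ≠ c g x}
  smul_mem' h c hc g x hg := by
    have := hc g (x * h) hg
    rwa [← mul_assoc] at this

theorem isClosed_proper : IsClosed (proper G : Set (ColoringSpace G)) := by
  have : (proper G : Set (ColoringSpace G)) =
      ⋂ g : G, ⋂ x : G, ⋂ _ : g ≠ 1, {c | c g (g * x) ≠ c g x} := by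
    ext c
    simp only [Set.mem_iInter]
    rfl
  rw [this]
  refine isClosed_iInter fun g => isClosed_iInter fun x => isClosed_iInter fun _ => ?_
  have hcont : Continuous fun c : ColoringSpace G => (c g (g * x), c g x) :=
    ((continuous_apply (g * x)).comp (continuous_apply g)).prodMk
      ((continuous_apply x).comp (continuous_apply g))
  exact (isClosed_discrete {p : Fin 3 × Fin 3 | p.1 ≠ p.2}).preimage hcont

theorem proper_nonempty [Countable G] : (proper G : Set (ColoringSpace G)).Nonempty := by
  have : ∀ g : G, ∃ c : G → Fin 3, g ≠ 1 → ∀ x, c (g * x) ≠ c x := fun g => by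
    by_cases hg : g = 1
    · exact ⟨fun _ => 0, fun h => absurd hg h⟩
    · obtain ⟨c, hc⟩ := exists_coloring_mul_left g hg
      exact ⟨c, fun _ => hc⟩
  choose c hc using this
  exact ⟨c, fun g x hg => hc g hg x⟩

theorem smul_ne_of_mem_proper {c : ColoringSpace G} (hc : c ∈ proper G) {g : G} (hg : g ≠ 1) :
    g • c ≠ c := by
  intro h
  apply hc g 1 hg
  have : c g (1 * g) = c g 1 := congrFun (congrFun h g) 1
  rw [one_mul] at this
  rwa [mul_one]

end ColoringSpace

/-- Every countable group has a free minimal zero-dimensional flow. -/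
theorem exists_free_minimal_zero_dimensional (G : Type u) [Group G] [Countable G] :
    ∃ (Z : Type u) (_ : TopologicalSpace Z) (_ : MulAction G Z), CompactSpace Z ∧ T2Space Z ∧
      SecondCountableTopology Z ∧ TotallyDisconnectedSpace Z ∧ Nonempty Z ∧
      ContinuousConstSMul G Z ∧ IsFreeAction G Z ∧ MulAction.IsMinimal G Z := by
  have : CompactSpace (ColoringSpace.proper G) :=
    isCompact_iff_compactSpace.mp (ColoringSpace.isClosed_proper G).isCompact
  have : Nonempty (ColoringSpace.proper G) := (ColoringSpace.proper_nonempty G).to_subtype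
  have : ContinuousConstSMul G (ColoringSpace.proper G) :=
    ⟨fun g => Continuous.subtype_mk
      ((continuous_const_smul g).comp continuous_subtype_val) _⟩
  have : SecondCountableTopology (ColoringSpace.proper G) :=
    Topology.IsEmbedding.subtypeVal.secondCountableTopology
  obtain ⟨X, hcl, hne, hmin⟩ := exists_subMulAction_isMinimal G (ColoringSpace.proper G)
  refine ⟨X, inferInstance, inferInstance, isCompact_iff_compactSpace.mp hcl.isCompact,
    inferInstanceAs (T2Space {x // x ∈ X}),
    Topology.IsEmbedding.subtypeVal.secondCountableTopology,
    inferInstanceAs (TotallyDisconnectedSpace {x : {x // x ∈ ColoringSpace.proper G} // x ∈ X}),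
    hne.to_subtype, ⟨fun g => Continuous.subtype_mk
      ((continuous_const_smul g).comp continuous_subtype_val) _⟩, ?_, hmin⟩
  intro g hg x hx
  exact ColoringSpace.smul_ne_of_mem_proper G x.1.2 hg
    (congrArg (fun y : X => ((y : ColoringSpace.proper G) : ColoringSpace G)) hx)

/-! ### Return times and disjoint translates -/

/-- An infinite subset of a group contains arbitrarily many elements whose translates by a given
finite set are disjoint. -/
theorem exists_disjoint_translates {G : Type*} [Group G] {R : Set G} (hR : R.Infinite)
    (W : Finset G) (n : ℕ) : ∃ t : Fin n → G, (∀ i, t i ∈ R) ∧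
      ∀ i j, ∀ v ∈ W, ∀ w ∈ W, v * t i = w * t j → i = j := by
  classical
  induction n with
  | zero => exact ⟨Fin.elim0, fun i => i.elim0, fun i => i.elim0⟩
  | succ n ih =>
    obtain ⟨t, ht, hd⟩ := ih
    let A : Finset G := ((W ×ˢ W) ×ˢ (Finset.univ : Finset (Fin n))).image
      fun p => p.1.1⁻¹ * (p.1.2 * t p.2)
    obtain ⟨r, hr, hrA⟩ := hR.exists_notMem_finset A
    have hA : ∀ v ∈ W, ∀ w ∈ W, ∀ i, v * r ≠ w * t i := by
      intro v hv w hw i h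
      apply hrA
      simp only [A, Finset.mem_image, Finset.mem_product, Finset.mem_univ, and_true]
      exact ⟨((v, w), i), ⟨hv, hw⟩, by rw [← h, inv_mul_cancel_left]⟩
    refine ⟨Fin.cons r t, fun i => Fin.cases hr ht i, fun i j v hv w hw => ?_⟩
    refine Fin.cases ?_ (fun i => ?_) i <;> refine Fin.cases ?_ (fun j => ?_) j
    · exact fun _ => rfl
    · exact fun h => absurd h (hA v hv w hw j)
    · exact fun h => absurd h.symm (hA w hw v hv i)
    · intro h
      rw [hd i j v hv w hw h]

/-- In a minimal action of an infinite group on a compact space, each point returns to each open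
set infinitely often. -/
theorem infinite_setOf_smul_mem {G Z : Type*} [Group G] [Infinite G] [TopologicalSpace Z]
    [CompactSpace Z] [MulAction G Z] [ContinuousConstSMul G Z] [MulAction.IsMinimal G Z]
    {V : Set Z} (hV : IsOpen V) (hne : V.Nonempty) (z : Z) : {g : G | g • z ∈ V}.Infinite := by
  classical
  intro hfin
  obtain ⟨I, hI⟩ := isCompact_univ.exists_finite_cover_smul G hV hne
  refine Set.infinite_univ (α := G) ((I.finite_toSet.mul hfin).subset fun h _ => ?_)
  have := hI (Set.mem_univ (h • z))
  simp only [Set.mem_iUnion] at this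
  obtain ⟨g, hg, hz⟩ := this
  rw [Set.mem_smul_set_iff_inv_smul_mem, smul_smul] at hz
  exact ⟨g, hg, g⁻¹ * h, hz, by simp⟩

/-- A point with trivial stabiliser has a clopen neighbourhood whose translates by a given finite
family of distinct group elements are disjoint. -/
theorem exists_isClopen_disjoint_translates {G Z : Type*} [Group G] [TopologicalSpace Z]
    [CompactSpace Z] [T2Space Z] [TotallyDisconnectedSpace Z] [MulAction G Z]
    [ContinuousConstSMul G Z] (hfree : IsFreeAction G Z) {J : Type*} [Finite J] {s : J → G}
    (hs : Function.Injective s) {V : Set Z} (hV : IsOpen V) {z : Z} (hz : z ∈ V) :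
    ∃ C : Set Z, IsClopen C ∧ z ∈ C ∧ C ⊆ V ∧
      ∀ j k x, (s j)⁻¹ • x ∈ C → (s k)⁻¹ • x ∈ C → j = k := by
  have hinj : Function.Injective fun j => s j • z := by
    intro j k h
    apply hs
    by_contra hne
    apply hfree ((s k)⁻¹ * s j) (fun h => hne (inv_mul_eq_one.mp h).symm) z
    rw [mul_smul, inv_smul_eq_iff]
    exact h
  obtain ⟨O, hO, hd⟩ := (Set.finite_range fun j => s j • z).t2_separation
  have hopen : IsOpen (V ∩ ⋂ j, (fun x => s j • x) ⁻¹' O (s j • z)) :=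
    hV.inter (isOpen_iInter_of_finite fun j => (hO _).2.preimage (continuous_const_smul _))
  obtain ⟨C, hC, hzC, hCs⟩ := compact_exists_isClopen_in_isOpen hopen
    ⟨hz, Set.mem_iInter.mpr fun j => (hO _).1⟩
  refine ⟨C, hC, hzC, fun x hx => (hCs hx).1, fun j k x hj hk => ?_⟩
  by_contra hne
  have h1 := Set.mem_iInter.mp (hCs hj).2 j
  have h2 := Set.mem_iInter.mp (hCs hk).2 k
  simp only [Set.mem_preimage, smul_inv_smul] at h1 h2
  exact Set.disjoint_left.mp (hd ⟨j, rfl⟩ ⟨k, rfl⟩ fun h => hne (hinj h)) h1 h2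

/-! ### The skew space and its endomorphisms -/

/-- The space of pairs of a point of `Z` and a function `G → Y`. -/
def SkewSpace (G Z Y : Type*) := Z × (G → Y)

namespace SkewSpace

variable {G H Z Y : Type*} [Group G] [Group H]

instance [TopologicalSpace Z] [TopologicalSpace Y] : TopologicalSpace (SkewSpace G Z Y) :=
  inferInstanceAs (TopologicalSpace (Z × (G → Y)))
instance [TopologicalSpace Z] [TopologicalSpace Y] [CompactSpace Z] [CompactSpace Y] :
    CompactSpace (SkewSpace G Z Y) :=
  inferInstanceAs (CompactSpace (Z × (G → Y)))
instance [TopologicalSpace Z] [TopologicalSpace Y] [T2Space Z] [T2Space Y] :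
    T2Space (SkewSpace G Z Y) :=
  inferInstanceAs (T2Space (Z × (G → Y)))
instance [Countable G] [TopologicalSpace Z] [TopologicalSpace Y] [SecondCountableTopology Z]
    [SecondCountableTopology Y] : SecondCountableTopology (SkewSpace G Z Y) :=
  inferInstanceAs (SecondCountableTopology (Z × (G → Y)))
instance [Nonempty Z] [Nonempty Y] : Nonempty (SkewSpace G Z Y) :=
  inferInstanceAs (Nonempty (Z × (G → Y)))

instance [MulAction G Z] [MulAction H Y] : MulAction (G × H) (SkewSpace G Z Y) where
  smul γ p := (γ.1 • p.1, fun x => γ.2 • p.2 (x * γ.1))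
  one_smul p := Prod.ext (one_smul G p.1) (funext fun x =>
    (one_smul H _).trans (congrArg p.2 (mul_one x)))
  mul_smul γ δ p := Prod.ext (mul_smul γ.1 δ.1 p.1) (funext fun x =>
    (mul_smul γ.2 δ.2 _).trans
      (congrArg (fun y => γ.2 • δ.2 • p.2 y) (mul_assoc x γ.1 δ.1).symm))

section

variable [MulAction G Z] [MulAction H Y]

theorem smul_fst (γ : G × H) (p : SkewSpace G Z Y) : (γ • p).1 = γ.1 • p.1 := rfl

theorem smul_snd (γ : G × H) (p : SkewSpace G Z Y) (x : G) :
    (γ • p).2 x = γ.2 • p.2 (x * γ.1) := rfl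

theorem isFreeAction (hZ : IsFreeAction G Z) (hY : IsFreeAction H Y) :
    IsFreeAction (G × H) (SkewSpace G Z Y) := by
  rintro ⟨g, h⟩ hne p hp
  have h1 : g • p.1 = p.1 := congrArg Prod.fst hp
  have hg : g = 1 := by
    by_contra hg
    exact hZ g hg _ h1
  subst hg
  have h2 : h • p.2 (1 * 1) = p.2 1 := congrFun (congrArg Prod.snd hp) 1
  rw [mul_one] at h2
  by_cases hh : h = 1
  · exact hne (by rw [hh]; rfl)
  · exact hY h hh _ h2

/-- The self-map which overwrites the value at `x` by `m j` applied to the value at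
`(s j)⁻¹ * x`, where `j = κ (x • z)`. -/
def overwrite {J : Type*} (s : J → G) (m : J → Y → Y) (κ : Z → Option J)
    (p : SkewSpace G Z Y) : SkewSpace G Z Y :=
  (p.1, fun x => match κ (x • p.1) with
    | some j => m j (p.2 ((s j)⁻¹ * x))
    | none => p.2 x)

variable {J : Type*} {s : J → G} {m : J → Y → Y} {κ : Z → Option J}

/-- The rule at `x` reads only `x • z` and values at left translates of `x`, whereas `G` acts by
right translation; `H` passes through each `m j`. -/
theorem overwrite_smul (hm : ∀ j (h : H) y, m j (h • y) = h • m j y) (γ : G × H)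
    (p : SkewSpace G Z Y) : overwrite s m κ (γ • p) = γ • overwrite s m κ p := by
  refine Prod.ext rfl (funext fun x => ?_)
  rw [smul_snd]
  simp only [overwrite, smul_fst, smul_snd, smul_smul]
  cases κ ((x * γ.1) • p.1) with
  | none => rfl
  | some j => simp only [hm, mul_assoc]

variable [TopologicalSpace Z] [TopologicalSpace Y]

instance [ContinuousConstSMul G Z] [ContinuousConstSMul H Y] :
    ContinuousConstSMul (G × H) (SkewSpace G Z Y) where
  continuous_const_smul γ := by
    refine Continuous.prodMk ((continuous_const_smul γ.1).comp continuous_fst)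
      (continuous_pi fun x => ?_)
    exact (continuous_const_smul γ.2).comp ((continuous_apply (x * γ.1)).comp continuous_snd)

theorem continuous_overwrite [ContinuousConstSMul G Z] (hm : ∀ j, Continuous (m j))
    (hκ : IsLocallyConstant κ) : Continuous (overwrite s m κ : SkewSpace G Z Y → _) := by
  refine Continuous.prodMk continuous_fst (continuous_pi fun x => ?_)
  let _ : TopologicalSpace (Option J) := ⊥
  have : DiscreteTopology (Option J) := ⟨rfl⟩
  have h1 : Continuous fun q : Option J × (G → Y) => (match q.1 with
      | some j => m j (q.2 ((s j)⁻¹ * x))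
      | none => q.2 x : Y) := by
    rw [continuous_prod_of_discrete_left]
    rintro (_ | j)
    · exact continuous_apply x
    · exact (hm j).comp (continuous_apply _)
  have h2 : Continuous fun p : SkewSpace G Z Y => (κ (x • p.1), p.2) :=
    (hκ.continuous.comp ((continuous_const_smul x).comp continuous_fst)).prodMk continuous_snd
  exact h1.comp h2

end

/-- If `Z` is a free minimal zero-dimensional `G`-flow and the equivariant self-maps of `Y` act
minimally, then each nonempty open set can be hit by the `G`-translates of each point in the image
of some equivariant self-map. -/
theorem exists_equivariant_forall_exists_smul_mem [Infinite G]
    [TopologicalSpace Z] [CompactSpace Z] [T2Space Z] [TotallyDisconnectedSpace Z]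
    [MulAction G Z] [ContinuousConstSMul G Z] [MulAction.IsMinimal G Z]
    (hfree : IsFreeAction G Z) [TopologicalSpace Y] [CompactSpace Y] [MulAction H Y]
    (hY : ∀ (y : Y) (U : Set Y), IsOpen U → U.Nonempty → ∃ m : Y → Y, Continuous m ∧
      (∀ (h : H) x, m (h • x) = h • m x) ∧ m y ∈ U)
    (U : Set (SkewSpace G Z Y)) (hU : IsOpen U) (hne : U.Nonempty) :
    ∃ φ : SkewSpace G Z Y → SkewSpace G Z Y, Continuous φ ∧
      (∀ (γ : G × H) x, φ (γ • x) = γ • φ x) ∧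
      ∀ x, ∃ g : G, ((g, 1) : G × H) • φ x ∈ U := by
  classical
  obtain ⟨⟨z, y⟩, hzy⟩ := hne
  obtain ⟨V, O', hV, hO', hzV, hyO', hVO⟩ := isOpen_prod_iff.mp hU z y hzy
  obtain ⟨W, O, hO, hOs⟩ := isOpen_pi_iff.mp hO' y hyO'
  have key : ∀ x : Y, ∃ m : W → Y → Y, ∀ w : W, Continuous (m w) ∧
      (∀ (h : H) x, m w (h • x) = h • m w x) ∧ m w x ∈ O w := fun x => by
    choose m hm using fun w : W => hY x (O w) (hO w w.2).1 ⟨y w, (hO w w.2).2⟩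
    exact ⟨m, hm⟩
  choose m hm using key
  -- Finitely many tuples `m x`, `x ∈ T`, suffice: every point of `Y` is sent into all the `O w`
  -- simultaneously by one of them.
  obtain ⟨T, hT⟩ := isCompact_univ.elim_finite_subcover
    (fun x : Y => ⋂ w : W, m x w ⁻¹' O w)
    (fun x => isOpen_iInter_of_finite fun w => (hO w w.2).1.preimage (hm x w).1)
    (fun x _ => Set.mem_iUnion.mpr ⟨x, Set.mem_iInter.mpr fun w => (hm x w).2.2⟩)
  obtain ⟨t, htV, ht⟩ := exists_disjoint_translates
    (infinite_setOf_smul_mem (G := G) hV ⟨z, hzV⟩ z) W T.card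
  let e := T.equivFin
  -- One return time `t i` per tuple; the window `W * t i` is reserved for writing the `i`-th
  -- candidate pattern.
  let s : Fin T.card × W → G := fun j => j.2 * t j.1
  have hs : Function.Injective s := by
    rintro ⟨i, v⟩ ⟨j, w⟩ h
    obtain rfl := ht i j v v.2 w w.2 h
    exact Prod.ext rfl (Subtype.ext (mul_right_cancel h))
  obtain ⟨C, hC, hzC, hCV, hCs⟩ := exists_isClopen_disjoint_translates hfree hs
    (isOpen_iInter_of_finite fun i => hV.preimage (continuous_const_smul (t i)))
    (Set.mem_iInter.mpr htV)
  let κ : Z → Option (Fin T.card × W) := fun x =>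
    if h : ∃ j, (s j)⁻¹ • x ∈ C then some h.choose else none
  have hκ : ∀ j x, κ x = some j ↔ (s j)⁻¹ • x ∈ C := by
    intro j x
    by_cases h : ∃ j, (s j)⁻¹ • x ∈ C
    · simp only [κ, dif_pos h, Option.some.injEq]
      exact ⟨fun hj => hj ▸ h.choose_spec, fun hj => hCs _ _ x h.choose_spec hj⟩
    · simp only [κ, dif_neg h]
      exact ⟨fun hj => by simp at hj, fun hj => absurd ⟨j, hj⟩ h⟩
  have hclopen : ∀ j, IsClopen {x | κ x = some j} := fun j => by
    simp only [hκ]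
    exact hC.preimage (continuous_const_smul (s j)⁻¹)
  have hκc : IsLocallyConstant κ := by
    rw [IsLocallyConstant.iff_isOpen_fiber]
    rintro (_ | j)
    · have : κ ⁻¹' {none} = (⋃ j, {x | κ x = some j})ᶜ := by
        ext x
        simp only [Set.mem_preimage, Set.mem_singleton_iff, Set.mem_compl_iff, Set.mem_iUnion,
          Set.mem_ofPred_eq, not_exists]
        cases κ x <;> simp
      rw [this]
      exact (isClosed_iUnion_of_finite fun j => (hclopen j).isClosed).isOpen_compl
    · exact (hclopen j).isOpen
  refine ⟨overwrite s (fun j => m (e.symm j.1) j.2) κ,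
    continuous_overwrite (fun j => (hm _ _).1) hκc,
    overwrite_smul (fun j => (hm _ _).2.1), fun p => ?_⟩
  -- At a visit `g` to `C`, all candidates computed from `p.2 g` are written in the windows `W * t i
  -- * g`. The index `i` that succeeds for `p.2 g` gives the translating element `t i * g`.
  obtain ⟨g, hg⟩ := hC.isOpen.exists_smul_mem G p.1 ⟨z, hzC⟩
  have hmem := hT (Set.mem_univ (p.2 g))
  simp only [Set.mem_iUnion] at hmem
  obtain ⟨x, hxT, hx⟩ := hmem
  let i := e ⟨x, hxT⟩
  refine ⟨t i * g, hVO ⟨?_, hOs fun w hw => ?_⟩⟩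
  · rw [smul_fst]
    change (t i * g) • p.1 ∈ V
    rw [mul_smul]
    exact Set.mem_iInter.mp (hCV hg) i
  · have hk : κ ((w * (t i * g)) • p.1) = some (i, ⟨w, hw⟩) := by
      rw [hκ, smul_smul]
      simpa [s, mul_assoc] using hg
    rw [smul_snd]
    simp only [overwrite, hk, one_smul]
    have : (s (i, ⟨w, hw⟩))⁻¹ * (w * (t i * g)) = g := by simp [s, mul_assoc]
    rw [this]
    have h2 : e.symm i = ⟨x, hxT⟩ := e.symm_apply_apply _
    rw [h2]
    exact Set.mem_iInter.mp hx ⟨w, hw⟩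

end SkewSpace

/-! ### Residual finiteness of free groups -/

namespace FreeGroup

variable {α : Type*} [DecidableEq α]

theorem finite_setOf_norm_le [Finite α] (n : ℕ) : {v : FreeGroup α | v.norm ≤ n}.Finite :=
  (List.finite_length_le (α × Bool) n).preimage toWord_injective.injOn

/-- The ball of radius `n` in the word norm. -/
abbrev Ball (α : Type*) [DecidableEq α] (n : ℕ) := {v : FreeGroup α // v.norm ≤ n}

/-- The identity element as a point of the ball. -/
def center (α : Type*) [DecidableEq α] (n : ℕ) : Ball α n := ⟨1, norm_one.trans_le n.zero_le⟩

instance [Finite α] (n : ℕ) : Finite (Ball α n) := (finite_setOf_norm_le n).to_subtype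

/-- The permutations of the ball of radius `n`, a finite group with the discrete topology. -/
def BallPerm (α : Type*) [DecidableEq α] (n : ℕ) := Equiv.Perm (Ball α n)

instance (n : ℕ) : Group (BallPerm α n) := inferInstanceAs (Group (Equiv.Perm (Ball α n)))
instance [Finite α] (n : ℕ) : Finite (BallPerm α n) :=
  inferInstanceAs (Finite (Equiv.Perm (Ball α n)))
instance (n : ℕ) : TopologicalSpace (BallPerm α n) := ⊥
instance (n : ℕ) : DiscreteTopology (BallPerm α n) := ⟨rfl⟩

/-- Left translation by a generator, defined where it preserves the ball, extends to a
permutation of the ball. -/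
theorem exists_ballPerm [Finite α] (n : ℕ) (s : α) : ∃ σ : Equiv.Perm (Ball α n),
    ∀ v w : Ball α n, w.1 = of s * v.1 → σ v = w := by
  classical
  have := Fintype.ofFinite (Ball α n)
  -- A partial injection of a finite set extends to a permutation.
  let e : {v : Ball α n // (of s * v.1).norm ≤ n} ≃ {v : Ball α n // ((of s)⁻¹ * v.1).norm ≤ n} :=
    { toFun := fun v => ⟨⟨of s * v.1.1, v.2⟩, by simpa using v.1.2⟩
      invFun := fun v => ⟨⟨(of s)⁻¹ * v.1.1, v.2⟩, by simpa using v.1.2⟩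
      left_inv := fun v => Subtype.ext (Subtype.ext (by simp))
      right_inv := fun v => Subtype.ext (Subtype.ext (by simp)) }
  refine ⟨e.extendSubtype, fun v w h => ?_⟩
  have hv : (of s * v.1).norm ≤ n := h ▸ w.2
  rw [e.extendSubtype_apply_of_mem v hv]
  exact Subtype.ext h.symm

/-- The free group on a finite set embeds in a product of finite groups. -/
theorem exists_injective_monoidHom_pi_ballPerm [Finite α] :
    ∃ ι : FreeGroup α →* ∀ n, BallPerm α n, Function.Injective ι := by
  choose σ hσ using fun n => exists_ballPerm (α := α) n
  let φ : ∀ n, FreeGroup α →* Equiv.Perm (Ball α n) := fun n => lift (σ n)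
  -- A word of length at most `n` moves the centre along a path inside the ball, where the
  -- permutations are true translations.
  have key : ∀ n (L : List (α × Bool)), L.length ≤ n →
      (φ n (mk L) (center α n)).1 = mk L := by
    intro n L
    induction L with
    | nil => intro _; rw [← one_eq_mk, _root_.map_one]; rfl
    | cons a L ih =>
      intro hL
      have hL' : L.length ≤ n := (Nat.le_succ _).trans hL
      have hcons : mk (a :: L) = mk [a] * mk L := by rw [mul_mk]; rfl
      have hn : (mk (a :: L)).norm ≤ n := norm_mk_le.trans hL
      have hn' : (mk L).norm ≤ n := norm_mk_le.trans hL'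
      have hL2 : φ n (mk L) (center α n) = ⟨mk L, hn'⟩ := Subtype.ext (ih hL')
      rw [hcons, _root_.map_mul, Equiv.Perm.mul_apply, hL2]
      rw [hcons] at hn
      obtain ⟨s, b⟩ := a
      cases b with
      | true =>
        have h1 : φ n (mk [(s, true)]) = σ n s := lift_apply_of
        rw [h1, hσ n s ⟨mk L, hn'⟩ ⟨_, hn⟩ rfl]
      | false =>
        have h0 : mk [(s, false)] = (of s)⁻¹ := rfl
        have h1 : φ n (mk [(s, false)]) = (σ n s)⁻¹ := by
          rw [h0, _root_.map_inv]
          exact congrArg _ lift_apply_of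
        rw [h1]
        have : (σ n s)⁻¹ ⟨mk L, hn'⟩ = ⟨_, hn⟩ := by
          rw [Equiv.Perm.inv_eq_iff_eq]
          exact (hσ n s ⟨_, hn⟩ ⟨_, hn'⟩ (mul_inv_cancel_left (of s) (mk L)).symm).symm
        rw [this]
  refine ⟨MonoidHom.pi φ, (injective_iff_map_eq_one _).mpr fun f hf => ?_⟩
  have h1 : φ f.norm f = 1 := congrFun hf f.norm
  have h2 := key f.norm f.toWord le_rfl
  rw [mk_toWord, h1] at h2
  exact h2.symm

end FreeGroup

/-! ### Edge functions on the Cayley graph and their deficits -/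

/-- The free group of rank two. -/
abbrev FreeTwo := FreeGroup (Fin 2)

/-- Families of pairs of real functions on the free group. -/
def FlowFamily := ℕ → Fin 2 → FreeTwo → ℝ

namespace FlowFamily

instance : TopologicalSpace FlowFamily :=
  inferInstanceAs (TopologicalSpace (ℕ → Fin 2 → FreeTwo → ℝ))
instance : T2Space FlowFamily := inferInstanceAs (T2Space (ℕ → Fin 2 → FreeTwo → ℝ))
instance : SecondCountableTopology FlowFamily :=
  inferInstanceAs (SecondCountableTopology (ℕ → Fin 2 → FreeTwo → ℝ))

instance : MulAction FreeTwo FlowFamily where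
  smul f u := fun n s v => u n s (v * f)
  one_smul u := by funext n s v; exact congrArg (u n s) (mul_one v)
  mul_smul f k u := by funext n s v; exact congrArg (u n s) (mul_assoc v f k).symm

theorem smul_apply (f : FreeTwo) (u : FlowFamily) (n : ℕ) (s : Fin 2) (v : FreeTwo) :
    (f • u) n s v = u n s (v * f) := rfl

theorem continuous_eval (n : ℕ) (s : Fin 2) (v : FreeTwo) :
    Continuous fun u : FlowFamily => u n s v :=
  (continuous_apply v).comp ((continuous_apply s).comp (continuous_apply n))

/-- The divergence at `v` of a function on the edges of the Cayley graph; the value `x s v` is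
the flow along the edge from `s⁻¹ * v` to `v`. -/
def divergence (x : Fin 2 → FreeTwo → ℝ) (v : FreeTwo) : ℝ :=
  ∑ s, (x s (FreeGroup.of s * v) - x s v)

/-- The amount by which the divergence at `v` falls short of `1`. -/
noncomputable def deficit (x : Fin 2 → FreeTwo → ℝ) (v : FreeTwo) : ℝ :=
  max 0 (1 - divergence x v)

theorem deficit_nonneg (x : Fin 2 → FreeTwo → ℝ) (v : FreeTwo) : 0 ≤ deficit x v :=
  le_max_left _ _

theorem continuous_divergence (n : ℕ) (v : FreeTwo) :
    Continuous fun u : FlowFamily => divergence (u n) v :=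
  continuous_finsetSum _ fun s _ => (continuous_eval n s _).sub (continuous_eval n s v)

theorem continuous_deficit (n : ℕ) (v : FreeTwo) :
    Continuous fun u : FlowFamily => deficit (u n) v :=
  continuous_const.max (continuous_const.sub (continuous_divergence n v))

/-- Families of flows bounded by `1` such that at each vertex the sum of the deficits is
at most `1`. -/
def bounded : SubMulAction FreeTwo FlowFamily where
  carrier := {u | (∀ n s v, u n s v ∈ Set.Icc (-1 : ℝ) 1) ∧
    ∀ v M, ∑ n ∈ Finset.range M, deficit (u n) v ≤ 1}
  smul_mem' f u hu := by
    refine ⟨fun n s v => hu.1 n s (v * f), fun v M => ?_⟩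
    have := hu.2 (v * f) M
    simp only [deficit, divergence, ← mul_assoc] at this
    exact this

theorem isCompact_bounded : IsCompact (bounded : Set FlowFamily) := by
  have h1 : IsCompact {u : FlowFamily | ∀ n s v, u n s v ∈ Set.Icc (-1 : ℝ) 1} := by
    have heq : {u : FlowFamily | ∀ n s v, u n s v ∈ Set.Icc (-1 : ℝ) 1} =
        (Set.univ.pi fun _ : ℕ => Set.univ.pi fun _ : Fin 2 =>
          Set.univ.pi fun _ : FreeTwo => Set.Icc (-1 : ℝ) 1 : Set (ℕ → Fin 2 → FreeTwo → ℝ)) := by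
      exact Set.ext fun u => ⟨fun h n _ s _ v _ => h n s v,
        fun h n s v => h n trivial s trivial v trivial⟩
    rw [heq]
    exact isCompact_univ_pi fun _ => isCompact_univ_pi fun _ =>
      isCompact_univ_pi fun _ => isCompact_Icc
  have h2 : IsClosed {u : FlowFamily | ∀ v M, ∑ n ∈ Finset.range M, deficit (u n) v ≤ 1} := by
    have : {u : FlowFamily | ∀ v M, ∑ n ∈ Finset.range M, deficit (u n) v ≤ 1} =
        ⋂ v, ⋂ M, {u : FlowFamily | ∑ n ∈ Finset.range M, deficit (u n) v ≤ 1} := by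
      ext u
      simp only [Set.mem_iInter]
      rfl
    rw [this]
    exact isClosed_iInter fun v => isClosed_iInter fun M => isClosed_le
      (continuous_finsetSum _ fun n _ => continuous_deficit n v) continuous_const
  exact h1.inter_right h2

open Classical in
/-- The flow directed away from the identity. -/
noncomputable def outward (s : Fin 2) (v : FreeTwo) : ℝ :=
  if v ∈ FreeGroup.startsWith (s, true) then 1 else -1

theorem outward_mem (s : Fin 2) (v : FreeTwo) : outward s v ∈ Set.Icc (-1 : ℝ) 1 := by
  unfold outward
  split_ifs <;> norm_num

/-- If `v` begins with `s⁻¹`, cancelling it leaves a word that cannot begin with `s`, because `v`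
was reduced. -/
theorem mul_mem_startsWith_iff (s : Fin 2) (v : FreeTwo) :
    FreeGroup.of s * v ∈ FreeGroup.startsWith (s, true) ↔
      v ∉ FreeGroup.startsWith (s, false) := by
  refine ⟨fun h hv => ?_, fun h => FreeGroup.startsWith_mk_mul v h⟩
  have hv' : v.toWord[0]? = some (s, false) := hv
  obtain ⟨L, hL⟩ : ∃ L, v.toWord = (s, false) :: L := by
    cases hw : v.toWord with
    | nil => simp [hw] at hv'
    | cons a L => exact ⟨L, by simpa [hw] using hv'⟩
  have hred := FreeGroup.isReduced_toWord (x := v)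
  rw [hL] at hred
  have hsv : FreeGroup.of s * v = FreeGroup.mk L := by
    rw [← FreeGroup.mk_toWord (x := v), hL,
      show FreeGroup.mk ((s, false) :: L) = (FreeGroup.of s)⁻¹ * FreeGroup.mk L from rfl,
      mul_inv_cancel_left]
  have h' : (FreeGroup.of s * v).toWord[0]? = some (s, true) := h
  cases L with
  | nil => simp [hsv] at h'
  | cons a L =>
    have h1 := FreeGroup.isReduced_cons_cons.mp hred
    rw [hsv, FreeGroup.toWord_mk, h1.2.reduce_eq] at h'
    have ha : a = (s, true) := by simpa using h'
    subst ha
    simpa using h1.1 rfl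

/-- In the 4-regular tree only the edge towards the identity points into a vertex: the divergence is
4 at the identity and 3 - 1 elsewhere. -/
theorem two_le_divergence_outward (v : FreeTwo) : 2 ≤ divergence outward v := by
  have key : ∀ s : Fin 2, outward s (FreeGroup.of s * v) - outward s v =
      2 - 2 * (if v.toWord[0]? = some (s, false) then 1 else 0) -
        2 * (if v.toWord[0]? = some (s, true) then 1 else 0) := by
    intro s
    have h1 : FreeGroup.of s * v ∈ FreeGroup.startsWith (s, true) ↔
      ¬ v.toWord[0]? = some (s, false) := mul_mem_startsWith_iff s v
    have h2 : v ∈ FreeGroup.startsWith (s, true) ↔ v.toWord[0]? = some (s, true) := Iff.rfl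
    unfold outward
    simp only [h1, h2]
    split_ifs with ha hb <;> norm_num
  unfold divergence
  rw [Fin.sum_univ_two, key, key]
  rcases v.toWord[0]? with _ | ⟨s, b⟩
  · simp
  · fin_cases s <;> cases b <;> simp

end FlowFamily

/-! ### Absence of invariant measures; averaging and interpolation -/

namespace FlowFamily

theorem deficit_outward (v : FreeTwo) : deficit outward v = 0 :=
  max_eq_left (by linarith [two_le_divergence_outward v])

theorem bounded_nonempty : (bounded : Set FlowFamily).Nonempty :=
  ⟨fun _ => outward, fun _ s v => outward_mem s v, fun v M => by simp [deficit_outward]⟩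

/-- No probability measure is invariant under an action which factors onto an action on bounded
families of flows. -/
theorem not_map_eq_of_equivariant {X : Type*} [TopologicalSpace X] [MeasurableSpace X]
    [BorelSpace X] (μ : Measure X) [IsProbabilityMeasure μ] (T : FreeTwo → X → X)
    (hT : ∀ f, Continuous (T f)) (θ : X → FlowFamily) (hθ : Continuous θ)
    (hθb : ∀ x, θ x ∈ bounded) (hθT : ∀ f x, θ (T f x) = f • θ x) :
    ¬ ∀ f, μ.map (T f) = μ := by
  intro hμ
  have hmeas : ∀ n s v, AEStronglyMeasurable (fun x => θ x n s v) μ := fun n s v =>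
    ((continuous_eval n s v).comp hθ).measurable.aestronglyMeasurable
  have hint : ∀ n s v, Integrable (fun x => θ x n s v) μ := fun n s v =>
    Integrable.of_bound (hmeas n s v) 1 (Filter.Eventually.of_forall fun x => by
      rw [Real.norm_eq_abs]
      exact abs_le.mpr ((hθb x).1 n s v))
  have hinv : ∀ n s f, ∫ x, θ x n s f ∂μ = ∫ x, θ x n s 1 ∂μ := by
    intro n s f
    have h1 := integral_map (μ := μ) (hT f).measurable.aemeasurable (f := fun x => θ x n s 1)
      (by rw [hμ]; exact hmeas n s 1)
    rw [hμ] at h1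
    rw [h1]
    simp only [hθT, smul_apply, one_mul]
  have hdivint : ∀ n, Integrable (fun x => divergence (θ x n) 1) μ := fun n =>
    integrable_finsetSum _ fun s _ => (hint n s _).sub (hint n s 1)
  have hdiv : ∀ n, ∫ x, divergence (θ x n) 1 ∂μ = 0 := by
    intro n
    have hi : ∀ s, Integrable (fun x => θ x n s (FreeGroup.of s * 1) - θ x n s 1) μ :=
      fun s => (hint n s _).sub (hint n s 1)
    have hz : ∀ s, ∫ x, (θ x n s (FreeGroup.of s * 1) - θ x n s 1) ∂μ = 0 := fun s => by
      rw [integral_sub (hint n s _) (hint n s 1), hinv, sub_self]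
    simp only [divergence, Fin.sum_univ_two]
    rw [integral_add (hi 0) (hi 1), hz, hz, add_zero]
  -- Two terms are needed: a single one could have deficit 1 and hence divergence 0.
  have hle : ∀ x, (1 : ℝ) ≤ divergence (θ x 0) 1 + divergence (θ x 1) 1 := by
    intro x
    have h := (hθb x).2 1 2
    rw [Finset.sum_range_succ, Finset.sum_range_one] at h
    have h0 : 1 - divergence (θ x 0) 1 ≤ deficit (θ x 0) 1 := le_max_right _ _
    have h1 : 1 - divergence (θ x 1) 1 ≤ deficit (θ x 1) 1 := le_max_right _ _
    linarith
  have := integral_mono (μ := μ) (integrable_const (1 : ℝ)) ((hdivint 0).add (hdivint 1)) hle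
  rw [integral_add' (hdivint 0) (hdivint 1), hdiv, hdiv] at this
  norm_num at this

/-- Averages over consecutive blocks of length `m`. -/
noncomputable def blockAverage (m : ℕ) (u : FlowFamily) : FlowFamily :=
  fun n s v => (m : ℝ)⁻¹ * ∑ j ∈ Finset.range m, u (n * m + j) s v

theorem continuous_blockAverage (m : ℕ) : Continuous (blockAverage m) :=
  continuous_pi fun n => continuous_pi fun s => continuous_pi fun v =>
    continuous_const.mul (continuous_finsetSum _ fun j _ => continuous_eval (n * m + j) s v)

theorem blockAverage_mem_Icc {m : ℕ} (hm : 0 < m) {u : FlowFamily}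
    (hu : ∀ n s v, u n s v ∈ Set.Icc (-1 : ℝ) 1) (n : ℕ) (s : Fin 2) (v : FreeTwo) :
    blockAverage m u n s v ∈ Set.Icc (-1 : ℝ) 1 := by
  have hm' : (0 : ℝ) < m := Nat.cast_pos.mpr hm
  have h1 : ∑ j ∈ Finset.range m, u (n * m + j) s v ≤ m := by
    simpa using Finset.sum_le_card_nsmul (Finset.range m) _ 1 fun j _ => (hu (n * m + j) s v).2
  have h2 : -(m : ℝ) ≤ ∑ j ∈ Finset.range m, u (n * m + j) s v := by
    simpa using Finset.card_nsmul_le_sum (Finset.range m) _ (-1) fun j _ =>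
      (hu (n * m + j) s v).1
  unfold blockAverage
  rw [inv_mul_eq_div]
  exact ⟨by rw [le_div_iff₀ hm']; linarith, by rw [div_le_iff₀ hm']; linarith⟩

/-- The deficit is the maximum of 0 and an affine function, hence convex. -/
theorem deficit_blockAverage_le {m : ℕ} (hm : 0 < m) (u : FlowFamily) (n : ℕ) (v : FreeTwo) :
    deficit (blockAverage m u n) v ≤
      (m : ℝ)⁻¹ * ∑ j ∈ Finset.range m, deficit (u (n * m + j)) v := by
  have hm' : (m : ℝ) ≠ 0 := (Nat.cast_pos.mpr hm).ne'
  have hdiv : 1 - divergence (blockAverage m u n) v =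
      (m : ℝ)⁻¹ * ∑ j ∈ Finset.range m, (1 - divergence (u (n * m + j)) v) := by
    simp only [divergence, blockAverage, Fin.sum_univ_two, Finset.sum_sub_distrib,
      Finset.sum_add_distrib, Finset.sum_const, Finset.card_range, nsmul_eq_mul, mul_one]
    field_simp
  refine max_le (mul_nonneg (by positivity) (Finset.sum_nonneg fun _ _ => deficit_nonneg _ _)) ?_
  rw [hdiv]
  exact mul_le_mul_of_nonneg_left (Finset.sum_le_sum fun j _ => le_max_right _ _) (by positivity)

theorem sum_range_mul_eq (f : ℕ → ℝ) (m M : ℕ) :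
    ∑ n ∈ Finset.range M, ∑ j ∈ Finset.range m, f (n * m + j) =
      ∑ i ∈ Finset.range (M * m), f i := by
  induction M with
  | zero => simp
  | succ M ih => rw [Finset.sum_range_succ, ih, Nat.succ_mul, Finset.sum_range_add]

/-- The blocks are disjoint, so each original deficit is counted once with weight `1 / m`. This gain
pays for inserting a pattern. -/
theorem sum_deficit_blockAverage_le {m : ℕ} (hm : 0 < m) {u : FlowFamily} (hu : u ∈ bounded)
    (v : FreeTwo) (M : ℕ) :
    ∑ n ∈ Finset.range M, deficit (blockAverage m u n) v ≤ (m : ℝ)⁻¹ := by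
  refine (Finset.sum_le_sum fun n _ => deficit_blockAverage_le hm u n v).trans ?_
  rw [← Finset.mul_sum, sum_range_mul_eq fun i => deficit (u i) v]
  exact mul_le_of_le_one_right (by positivity) (hu.2 v _)

/-- The deficit of a slowly varying interpolation between two bounded flows. -/
theorem deficit_interpolate_le {x y z : Fin 2 → FreeTwo → ℝ} {t : FreeTwo → ℝ} {v : FreeTwo}
    {ε : ℝ} (hx : ∀ s w, x s w ∈ Set.Icc (-1 : ℝ) 1) (hy : ∀ s w, y s w ∈ Set.Icc (-1 : ℝ) 1)
    (ht : t v ∈ Set.Icc (0 : ℝ) 1) (hslope : ∀ s, |t (FreeGroup.of s * v) - t v| ≤ ε)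
    (hz : ∀ s, z s v = x s v + t v * (y s v - x s v))
    (hz' : ∀ s, z s (FreeGroup.of s * v) = x s (FreeGroup.of s * v) +
      t (FreeGroup.of s * v) * (y s (FreeGroup.of s * v) - x s (FreeGroup.of s * v))) :
    deficit z v ≤ (1 - t v) * deficit x v + t v * deficit y v + 4 * ε := by
  have hε : 0 ≤ ε := (abs_nonneg _).trans (hslope 0)
  have hx0 := deficit_nonneg x v
  have hy0 := deficit_nonneg y v
  have hx1 : 1 - divergence x v ≤ deficit x v := le_max_right _ _
  have hy1 : 1 - divergence y v ≤ deficit y v := le_max_right _ _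
  -- The Leibniz error: slope at most `ε` times a difference at most 2, for each of two generators.
  have herr : ∀ s, -(2 * ε) ≤ (t (FreeGroup.of s * v) - t v) *
      (y s (FreeGroup.of s * v) - x s (FreeGroup.of s * v)) := by
    intro s
    have h1 : |y s (FreeGroup.of s * v) - x s (FreeGroup.of s * v)| ≤ 2 := by
      have h2 := hx s (FreeGroup.of s * v)
      have h3 := hy s (FreeGroup.of s * v)
      exact abs_le.mpr ⟨by linarith [h2.2, h3.1], by linarith [h2.1, h3.2]⟩
    have h4 := mul_le_mul (hslope s) h1 (abs_nonneg _) hε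
    rw [← abs_mul] at h4
    linarith [(abs_le.mp h4).1]
  have hdiv : 1 - divergence z v = (1 - t v) * (1 - divergence x v) +
      t v * (1 - divergence y v) - ∑ s, (t (FreeGroup.of s * v) - t v) *
        (y s (FreeGroup.of s * v) - x s (FreeGroup.of s * v)) := by
    simp only [divergence, Fin.sum_univ_two, hz, hz']
    ring
  have h1 := mul_le_mul_of_nonneg_left hx1 (sub_nonneg.mpr ht.2)
  have h2 := mul_le_mul_of_nonneg_left hy1 ht.1
  refine max_le ?_ ?_
  · have := mul_nonneg (sub_nonneg.mpr ht.2) hx0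
    have := mul_nonneg ht.1 hy0
    linarith
  · rw [hdiv, Fin.sum_univ_two]
    linarith [herr 0, herr 1]

/-- Slowly varying finitely supported functions which are `1` on a given ball. -/
theorem exists_slowly_varying (r : ℕ) {ε : ℝ} (hε : 0 < ε) : ∃ (τ : FreeTwo → ℝ)
    (E : Finset FreeTwo), (∀ v, τ v ∈ Set.Icc (0 : ℝ) 1) ∧ (∀ v, v.norm ≤ r → τ v = 1) ∧
      (∀ v ∉ E, τ v = 0) ∧ ∀ s v, |τ (FreeGroup.of s * v) - τ v| ≤ ε := by
  obtain ⟨k, hk⟩ := exists_nat_ge (1 / ε)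
  refine ⟨fun v => max 0 (min 1 (1 - ε * ((v.norm : ℝ) - r))),
    (FreeGroup.finite_setOf_norm_le (r + k)).toFinset, fun v => ?_, fun v hv => ?_,
    fun v hv => ?_, fun s v => ?_⟩
  · exact ⟨le_max_left _ _, max_le zero_le_one (min_le_left _ _)⟩
  · have hv' : (v.norm : ℝ) ≤ r := Nat.cast_le.mpr hv
    have : ε * ((v.norm : ℝ) - r) ≤ 0 := mul_nonpos_of_nonneg_of_nonpos hε.le (by linarith)
    simp only
    rw [min_eq_left (by linarith), max_eq_right zero_le_one]
  · have hv' : r + k < v.norm := by simpa using hv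
    have hv2 : (r : ℝ) + k < v.norm := by exact_mod_cast hv'
    apply max_eq_left
    refine (min_le_right _ _).trans ?_
    rw [div_le_iff₀ hε] at hk
    nlinarith
  · have h1 : (FreeGroup.of s * v).norm ≤ v.norm + 1 := by
      have := FreeGroup.norm_mul_le (FreeGroup.of s) v
      rw [FreeGroup.norm_of] at this
      omega
    have h2 : v.norm ≤ (FreeGroup.of s * v).norm + 1 := by
      have := FreeGroup.norm_mul_le (FreeGroup.of s)⁻¹ (FreeGroup.of s * v)
      rw [inv_mul_cancel_left, FreeGroup.norm_inv_eq, FreeGroup.norm_of] at this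
      omega
    have h1' : ((FreeGroup.of s * v).norm : ℝ) ≤ v.norm + 1 := by exact_mod_cast h1
    have h2' : (v.norm : ℝ) ≤ (FreeGroup.of s * v).norm + 1 := by exact_mod_cast h2
    have h3 : |1 - ε * (((FreeGroup.of s * v).norm : ℝ) - r) - (1 - ε * ((v.norm : ℝ) - r))| ≤
        ε := abs_le.mpr ⟨by nlinarith, by nlinarith⟩
    refine (abs_max_sub_max_le_max _ _ _ _).trans (max_le (by simpa using hε.le) ?_)
    exact (abs_min_sub_min_le_max _ _ _ _).trans (max_le (by simpa using hε.le) h3)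

/-- A neighbourhood of a family of flows contains all families which agree with it on some finite
set of coordinates. -/
theorem exists_forall_eq_imp_mem {U : Set FlowFamily} (hU : IsOpen U) {q : FlowFamily}
    (hq : q ∈ U) : ∃ N : ℕ, ∀ u : FlowFamily,
      (∀ n < N, ∀ s, ∀ v : FreeTwo, v.norm ≤ N → u n s v = q n s v) → u ∈ U := by
  by_contra! hcon
  choose u hu hu' using hcon
  have hlim : Filter.Tendsto u Filter.atTop (nhds q) := by
    refine tendsto_pi_nhds.mpr fun n => tendsto_pi_nhds.mpr fun s => tendsto_pi_nhds.mpr fun v => ?_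
    refine tendsto_const_nhds.congr' ?_
    filter_upwards [Filter.eventually_gt_atTop n, Filter.eventually_ge_atTop v.norm] with N h1 h2
    exact (hu N n h1 s v h2).symm
  obtain ⟨N, hN⟩ := (hlim.eventually_mem (hU.mem_nhds hq)).exists
  exact hu' N hN

/-- The family `(1 - κ) u + κ w`, with `w` the outward flow. -/
noncomputable def mixOutward (κ : ℝ) (u : FlowFamily) : FlowFamily :=
  fun n s v => (1 - κ) * u n s v + κ * outward s v

theorem mixOutward_mem_Icc {κ : ℝ} (hκ : κ ∈ Set.Icc (0 : ℝ) 1) {u : FlowFamily}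
    (hu : ∀ n s v, u n s v ∈ Set.Icc (-1 : ℝ) 1) (n : ℕ) (s : Fin 2) (v : FreeTwo) :
    mixOutward κ u n s v ∈ Set.Icc (-1 : ℝ) 1 :=
  (convex_Icc (-1 : ℝ) 1) (hu n s v) (outward_mem s v) (sub_nonneg.mpr hκ.2) hκ.1
    (sub_add_cancel 1 κ)

theorem deficit_mixOutward_le {κ : ℝ} (hκ : κ ∈ Set.Icc (0 : ℝ) 1) (u : FlowFamily) (n : ℕ)
    (v : FreeTwo) : deficit (mixOutward κ u n) v ≤ (1 - κ) * deficit (u n) v := by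
  have h0 := deficit_nonneg (u n) v
  have h1 : 1 - divergence (u n) v ≤ deficit (u n) v := le_max_right _ _
  have hdiv : 1 - divergence (mixOutward κ u n) v =
      (1 - κ) * (1 - divergence (u n) v) + κ * (1 - divergence outward v) := by
    simp only [divergence, mixOutward, Fin.sum_univ_two]
    ring
  refine max_le (mul_nonneg (sub_nonneg.mpr hκ.2) h0) ?_
  rw [hdiv]
  have h2 := mul_le_mul_of_nonneg_left h1 (sub_nonneg.mpr hκ.2)
  have h3 := mul_nonneg hκ.1 (sub_nonneg.mpr ((one_le_two (α := ℝ)).trans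
    (two_le_divergence_outward v)))
  linarith

/-- Families with strictly smaller total deficit are dense among the bounded ones. -/
theorem exists_mixOutward_mem {U : Set FlowFamily} (hU : IsOpen U) {u : FlowFamily} (hu : u ∈ U) :
    ∃ κ : ℝ, 0 < κ ∧ κ ≤ 1 ∧ mixOutward κ u ∈ U := by
  have hc : Continuous fun κ : ℝ => mixOutward κ u :=
    continuous_pi fun n => continuous_pi fun s => continuous_pi fun v => by
      unfold mixOutward
      fun_prop
  have h0 : mixOutward 0 u = u := by
    funext n s v
    simp [mixOutward]
  have hev : ∀ᶠ κ : ℝ in nhdsWithin 0 (Set.Ioi 0), mixOutward κ u ∈ U :=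
    (hc.tendsto 0).eventually_mem (hU.mem_nhds (by rwa [h0])) |>.filter_mono nhdsWithin_le_nhds
  obtain ⟨κ, h1, h2⟩ := (hev.and (Ioc_mem_nhdsGT (zero_lt_one (α := ℝ)))).exists
  exact ⟨κ, h2.1, h2.2, h1⟩

end FlowFamily

/-! ### Inserting prescribed patterns equivariantly -/

/-- In a free flow, each point carries a bump function which vanishes on given translates of its
support. -/
theorem exists_bump {F B : Type*} [Group F] [TopologicalSpace B] [CompactSpace B] [T2Space B]
    [MulAction F B] [ContinuousConstSMul F B] (hfree : IsFreeAction F B) (b : B)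
    (D : Finset F) : ∃ χ : B → ℝ, Continuous χ ∧ (∀ x, χ x ∈ Set.Icc (0 : ℝ) 1) ∧ χ b = 1 ∧
      ∀ d ∈ D, d ≠ 1 → ∀ x, χ x ≠ 0 → χ (d • x) = 0 := by
  have hsep : ∀ d : F, ∃ O : Set B, IsOpen O ∧ b ∈ O ∧ (d ≠ 1 → ∀ x ∈ O, d • x ∉ O) := by
    intro d
    by_cases hd : d = 1
    · exact ⟨Set.univ, isOpen_univ, Set.mem_univ _, fun h => absurd hd h⟩
    · obtain ⟨O₁, O₂, h1, h2, hb1, hb2, hdis⟩ := t2_separation (hfree d hd b)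
      exact ⟨O₂ ∩ (fun x => d • x) ⁻¹' O₁, h2.inter (h1.preimage (continuous_const_smul d)),
        ⟨hb2, hb1⟩, fun _ x hx hdx => Set.disjoint_left.mp hdis hx.2 hdx.1⟩
  choose O hO hbO hdO using hsep
  have hopen : IsOpen (⋂ d ∈ D, O d) := isOpen_biInter_finset fun d _ => hO d
  obtain ⟨χ, h0, h1, h01⟩ := exists_continuous_zero_one_of_isClosed hopen.isClosed_compl
    (isClosed_singleton (x := b)) (Set.disjoint_singleton_right.mpr fun h =>
      h (Set.mem_iInter₂.mpr fun d _ => hbO d))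
  refine ⟨χ, χ.continuous, h01, h1 rfl, fun d hd hd1 x hx => h0 fun hmem => ?_⟩
  have hxO : x ∈ ⋂ d ∈ D, O d := by
    by_contra hcon
    exact hx (h0 hcon)
  exact hdO d hd1 x (Set.mem_iInter₂.mp hxO d hd) (Set.mem_iInter₂.mp hmem d hd)

namespace FlowFamily

variable {B : Type*} [MulAction FreeTwo B]

/-- The interpolation, in the first `N` coordinates, between `u` and the translates of `q` centred
at those `c` for which `c • b` lies in the support of `χ`. -/
noncomputable def insertCopies (χ : B → ℝ) (τ : FreeTwo → ℝ) (E : Finset FreeTwo) (N : ℕ)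
    (q : FlowFamily) (b : B) (u : FlowFamily) : FlowFamily :=
  fun n s v => if n < N then
    u n s v + ∑ e ∈ E, χ ((e⁻¹ * v) • b) * τ e * (q n s e - u n s v) else u n s v

theorem insertCopies_smul (χ : B → ℝ) (τ : FreeTwo → ℝ) (E : Finset FreeTwo) (N : ℕ)
    (q : FlowFamily) (f : FreeTwo) (b : B) (u : FlowFamily) :
    insertCopies χ τ E N q (f • b) (f • u) = f • insertCopies χ τ E N q b u := by
  funext n s v
  simp only [smul_apply, insertCopies, smul_smul, mul_assoc]

theorem continuous_insertCopies [TopologicalSpace B] [ContinuousConstSMul FreeTwo B]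
    {χ : B → ℝ} (hχ : Continuous χ)
    (τ : FreeTwo → ℝ) (E : Finset FreeTwo) (N : ℕ) (q : FlowFamily) :
    Continuous fun p : B × FlowFamily => insertCopies χ τ E N q p.1 p.2 := by
  refine continuous_pi fun n => continuous_pi fun s => continuous_pi fun v => ?_
  have hu : Continuous fun p : B × FlowFamily => p.2 n s v :=
    (continuous_eval n s v).comp continuous_snd
  unfold insertCopies
  split_ifs
  · refine hu.add (continuous_finsetSum _ fun e _ => ?_)
    exact ((hχ.comp ((continuous_const_smul _).comp continuous_fst)).mul continuous_const).mul
      (continuous_const.sub hu)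
  · exact hu

/-- Locally, at most one translate contributes to the sum defining `insertCopies`. -/
theorem exists_sum_eq {χ : B → ℝ} {τ : FreeTwo → ℝ} {E E' : Finset FreeTwo}
    (hτ : ∀ v ∉ E, τ v = 0) (hE : ∀ e ∈ E, e ∈ E' ∧ ∀ s, (FreeGroup.of s)⁻¹ * e ∈ E')
    (hχ : ∀ d ∈ E', ∀ e ∈ E', d⁻¹ * e ≠ 1 → ∀ x, χ x ≠ 0 → χ ((d⁻¹ * e) • x) = 0)
    (b : B) (v : FreeTwo) :
    ∃ c : FreeTwo, ∀ x, (x = v ∨ ∃ s, x = FreeGroup.of s * v) → ∀ g : FreeTwo → ℝ,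
      ∑ e ∈ E, χ ((e⁻¹ * x) • b) * τ e * g e =
        χ (c • b) * τ (x * c⁻¹) * g (x * c⁻¹) := by
  have hE' : ∀ x, (x = v ∨ ∃ s, x = FreeGroup.of s * v) → ∀ c, x * c⁻¹ ∈ E → v * c⁻¹ ∈ E' := by
    rintro x (rfl | ⟨s, rfl⟩) c hc
    · exact (hE _ hc).1
    · have := (hE _ hc).2 s
      rwa [mul_assoc, inv_mul_cancel_left] at this
  -- Two active centres within reach of `v` would contradict the disjointness property of `χ`.
  -- Enlarging `E` to `E'` makes the same centre serve `v` and the vertices `s * v`.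
  by_cases hex : ∃ c, χ (c • b) ≠ 0 ∧ v * c⁻¹ ∈ E'
  · obtain ⟨c, hc, hcE⟩ := hex
    refine ⟨c, fun x hx g => ?_⟩
    rw [Finset.sum_eq_single (x * c⁻¹)]
    · simp
    · intro e he hne
      have h1 : v * (e⁻¹ * x)⁻¹ ∈ E' := hE' x hx _ (by simpa using he)
      have h2 := hχ _ h1 _ hcE (fun h => hne ?_) (c • b) hc
      · rw [smul_smul] at h2
        have h3 : (v * (e⁻¹ * x)⁻¹)⁻¹ * (v * c⁻¹) * c = e⁻¹ * x := by group
        rw [h3] at h2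
        simp [h2]
      · have h4 := inv_mul_eq_one.mp h
        have h5 : (e⁻¹ * x)⁻¹ = c⁻¹ := mul_left_cancel h4
        rw [← h5]
        group
    · intro hnot
      rw [hτ _ hnot]
      simp
  · push Not at hex
    have hzero : ∀ x, (x = v ∨ ∃ s, x = FreeGroup.of s * v) → ∀ c,
        χ (c • b) * τ (x * c⁻¹) = 0 := by
      intro x hx c
      by_cases h : χ (c • b) = 0
      · rw [h, zero_mul]
      · rw [hτ _ fun hmem => hex c h (hE' x hx c hmem), mul_zero]
    refine ⟨1, fun x hx g => ?_⟩
    rw [hzero x hx, zero_mul]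
    refine Finset.sum_eq_zero fun e _ => ?_
    have := hzero x hx (e⁻¹ * x)
    rw [mul_inv_rev, inv_inv, mul_inv_cancel_left] at this
    rw [this, zero_mul]

/-- The equivariant maps from `B × bounded` to `bounded` can take the points over a given
`b : B` into any given nonempty open set. -/
theorem exists_equivariant_mem [TopologicalSpace B] [CompactSpace B] [T2Space B]
    [ContinuousConstSMul FreeTwo B]
    (hfree : IsFreeAction FreeTwo B) (b : B) (U : Set bounded) (hU : IsOpen U)
    (hne : U.Nonempty) : ∃ m : B × bounded → bounded, Continuous m ∧
      (∀ (f : FreeTwo) x, m (f • x) = f • m x) ∧ ∀ u, m (b, u) ∈ U := by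
  classical
  obtain ⟨O, hO, rfl⟩ := isOpen_induced_iff.mp hU
  obtain ⟨⟨p, hp⟩, hpU⟩ := hne
  obtain ⟨κ, hκ, hκ1, hqU⟩ := exists_mixOutward_mem hO hpU
  set q := mixOutward κ p with hq
  have hκI : κ ∈ Set.Icc (0 : ℝ) 1 := ⟨hκ.le, hκ1⟩
  have hqI : ∀ n s v, q n s v ∈ Set.Icc (-1 : ℝ) 1 := mixOutward_mem_Icc hκI hp.1
  have hqsum : ∀ v M, ∑ n ∈ Finset.range M, deficit (q n) v ≤ 1 - κ := fun v M => by
    refine (Finset.sum_le_sum fun n _ => deficit_mixOutward_le hκI p n v).trans ?_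
    rw [← Finset.mul_sum]
    exact mul_le_of_le_one_right (sub_nonneg.mpr hκ1) (hp.2 v M)
  obtain ⟨N, hN⟩ := exists_forall_eq_imp_mem hO hqU
  -- The slack `κ` in the deficit of `q` is split: half for the block average, half for the
  -- interpolation error `4 * ε` in each of the first `N` coordinates.
  obtain ⟨k, hk⟩ := exists_nat_one_div_lt (half_pos hκ)
  have hm : 0 < k + 1 := k.succ_pos
  have hkm : ((k + 1 : ℕ) : ℝ)⁻¹ ≤ κ / 2 := by
    rw [inv_eq_one_div]
    exact_mod_cast hk.le
  set ε : ℝ := κ / (8 * (N + 1)) with hε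
  have hε0 : 0 < ε := by positivity
  have hεN : N * (4 * ε) ≤ κ / 2 := by
    rw [hε]
    have : (0 : ℝ) < N + 1 := by positivity
    field_simp
    nlinarith
  obtain ⟨τ, E, hτI, hτ1, hτ0, hτs⟩ := exists_slowly_varying N hε0
  let E' : Finset FreeTwo := E ∪ Finset.univ.biUnion fun s : Fin 2 =>
    E.image fun e => (FreeGroup.of s)⁻¹ * e
  have hE : ∀ e ∈ E, e ∈ E' ∧ ∀ s, (FreeGroup.of s)⁻¹ * e ∈ E' := fun e he =>
    ⟨Finset.mem_union_left _ he, fun s => Finset.mem_union_right _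
      (Finset.mem_biUnion.mpr ⟨s, Finset.mem_univ _, Finset.mem_image_of_mem _ he⟩)⟩
  obtain ⟨χ, hχc, hχI, hχb, hχ⟩ := exists_bump hfree b
    ((E' ×ˢ E').image fun d => d.1⁻¹ * d.2)
  have hχ' : ∀ d ∈ E', ∀ e ∈ E', d⁻¹ * e ≠ 1 → ∀ x, χ x ≠ 0 → χ ((d⁻¹ * e) • x) = 0 :=
    fun d hd e he => hχ _ (Finset.mem_image.mpr ⟨(d, e), Finset.mk_mem_product hd he, rfl⟩)
  let Φ : B → FlowFamily → FlowFamily := fun c u =>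
    insertCopies χ τ E N q c (blockAverage (k + 1) u)
  have hΦ : ∀ c : B, ∀ u ∈ bounded, Φ c u ∈ bounded := by
    intro c u hu
    have hI := blockAverage_mem_Icc hm hu.1
    have hloc : ∀ v : FreeTwo, ∃ a : FreeTwo, ∀ n < N, ∀ s x,
        (x = v ∨ ∃ s, x = FreeGroup.of s * v) → Φ c u n s x =
          blockAverage (k + 1) u n s x + χ (a • c) * τ (x * a⁻¹) *
            (q n s (x * a⁻¹) - blockAverage (k + 1) u n s x) := by
      intro v
      obtain ⟨a, ha⟩ := exists_sum_eq hτ0 hE hχ' c v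
      refine ⟨a, fun n hn s x hx => ?_⟩
      simp only [Φ, insertCopies, if_pos hn]
      rw [ha x hx fun e => q n s e - blockAverage (k + 1) u n s x]
    have hge : ∀ n, ¬ n < N → Φ c u n = blockAverage (k + 1) u n := fun n hn => by
      funext s v
      simp only [Φ, insertCopies, if_neg hn]
    have htI : ∀ a v : FreeTwo, χ (a • c) * τ (v * a⁻¹) ∈ Set.Icc (0 : ℝ) 1 := fun a v =>
      ⟨mul_nonneg (hχI _).1 (hτI _).1, mul_le_one₀ (hχI _).2 (hτI _).1 (hτI _).2⟩
    refine ⟨fun n s v => ?_, fun v M => ?_⟩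
    · by_cases hn : n < N
      · obtain ⟨a, ha⟩ := hloc v
        rw [ha n hn s v (Or.inl rfl)]
        have := (convex_Icc (-1 : ℝ) 1) (hI n s v) (hqI n s (v * a⁻¹))
          (sub_nonneg.mpr (htI a v).2) (htI a v).1 (sub_add_cancel _ _)
        simp only [smul_eq_mul] at this
        convert this using 1
        ring
      · rw [hge n hn]
        exact hI n s v
    · obtain ⟨a, ha⟩ := hloc v
      have hterm : ∀ n, deficit (Φ c u n) v ≤ deficit (blockAverage (k + 1) u n) v +
          deficit (q n) (v * a⁻¹) + if n < N then 4 * ε else 0 := by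
        intro n
        have hI0 := deficit_nonneg (blockAverage (k + 1) u n) v
        have hq0 := deficit_nonneg (q n) (v * a⁻¹)
        by_cases hn : n < N
        · have hq' : deficit (fun s x => q n s (x * a⁻¹)) v = deficit (q n) (v * a⁻¹) := by
            simp only [deficit, divergence, mul_assoc]
          have h := deficit_interpolate_le (x := blockAverage (k + 1) u n)
            (y := fun s x => q n s (x * a⁻¹)) (z := Φ c u n)
            (t := fun x => χ (a • c) * τ (x * a⁻¹)) (v := v) (ε := ε) (hI n)
            (fun s w => hqI n s _) (htI a v) (fun s => by
              rw [← mul_sub, abs_mul, mul_assoc, abs_of_nonneg (hχI _).1]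
              exact (mul_le_of_le_one_left (abs_nonneg _) (hχI _).2).trans (hτs s _))
            (fun s => ha n hn s v (Or.inl rfl)) (fun s => ha n hn s _ (Or.inr ⟨s, rfl⟩))
          rw [hq'] at h
          rw [if_pos hn]
          have h1 := mul_le_of_le_one_left hI0 (sub_le_self 1 (htI a v).1)
          have h2 := mul_le_of_le_one_left hq0 (htI a v).2
          linarith
        · rw [hge n hn, if_neg hn]
          linarith
      -- Total: `κ / 2 + (1 - κ) + κ / 2 = 1`.
      refine (Finset.sum_le_sum fun n _ => hterm n).trans ?_
      rw [Finset.sum_add_distrib, Finset.sum_add_distrib]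
      have h1 := sum_deficit_blockAverage_le hm hu v M
      have h2 := hqsum (v * a⁻¹) M
      have h3 : ∑ n ∈ Finset.range M, (if n < N then 4 * ε else 0) ≤ N * (4 * ε) := by
        rw [← Finset.sum_filter, Finset.sum_const, nsmul_eq_mul]
        refine mul_le_mul_of_nonneg_right ?_ (by positivity)
        have : (Finset.range M).filter (fun n => n < N) ⊆ Finset.range N := fun n hn =>
          Finset.mem_range.mpr (Finset.mem_filter.mp hn).2
        exact_mod_cast (Finset.card_le_card this).trans_eq (Finset.card_range N)
      linarith
  refine ⟨fun x => ⟨Φ x.1 x.2, hΦ x.1 x.2 x.2.2⟩, ?_, ?_, fun u => ?_⟩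
  · refine Continuous.subtype_mk ?_ _
    exact (continuous_insertCopies hχc τ E N q).comp (continuous_fst.prodMk
      ((continuous_blockAverage _).comp (continuous_subtype_val.comp continuous_snd)))
  · intro f x
    exact Subtype.ext (insertCopies_smul χ τ E N q f x.1 (blockAverage (k + 1) x.2))
  -- Over `b` the centre `1` is fully active, so on the ball of radius `N` the result is exactly
  -- `q`, whatever `u` is.
  · refine hN _ fun n hn s v hv => ?_
    have hvE : v ∈ E := by
      by_contra hcon
      have h1 := hτ1 v hv
      rw [hτ0 v hcon] at h1
      exact zero_ne_one h1
    simp only [Φ, insertCopies, if_pos hn]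
    rw [Finset.sum_eq_single_of_mem v hvE]
    · rw [inv_mul_cancel, one_smul, hχb, hτ1 v hv]
      ring
    · intro e he hne
      have hne' : e⁻¹ * v ≠ 1 := fun h => hne (inv_mul_eq_one.mp h)
      rw [hχ' e (hE e he).1 v (hE v hvE).1 hne' b (by rw [hχb]; exact one_ne_zero)]
      ring

end FlowFamily

/-! ### Assembling the flows -/

/-- There is a free compact flow of the free group of rank two, without invariant probability
measures, on which the equivariant continuous self-maps act minimally. -/
theorem exists_freeTwo_flow : ∃ (Y : Type) (_ : TopologicalSpace Y) (_ : MulAction FreeTwo Y),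
    CompactSpace Y ∧ T2Space Y ∧ SecondCountableTopology Y ∧ Nonempty Y ∧
      ContinuousConstSMul FreeTwo Y ∧ IsFreeAction FreeTwo Y ∧
      (∀ (y : Y) (U : Set Y), IsOpen U → U.Nonempty → ∃ m : Y → Y, Continuous m ∧
        (∀ (f : FreeTwo) x, m (f • x) = f • m x) ∧ m y ∈ U) ∧
      ∃ θ : Y → FlowFamily, Continuous θ ∧ (∀ y, θ y ∈ FlowFamily.bounded) ∧
        ∀ (f : FreeTwo) y, θ (f • y) = f • θ y := by
  obtain ⟨ι, hι⟩ := FreeGroup.exists_injective_monoidHom_pi_ballPerm (α := Fin 2)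
  let K := ∀ n, FreeGroup.BallPerm (Fin 2) n
  let _ : MulAction FreeTwo K := MulAction.compHom K ι
  have hsmul : ∀ (f : FreeTwo) (k : K), f • k = ι f * k := fun _ _ => rfl
  have : ContinuousConstSMul FreeTwo K := ⟨fun f => continuous_const_mul (ι f)⟩
  have hfree : IsFreeAction FreeTwo K := by
    intro f hf k hk
    rw [hsmul, mul_eq_right] at hk
    exact hf (hι (hk.trans ι.map_one.symm))
  have : CompactSpace FlowFamily.bounded :=
    isCompact_iff_compactSpace.mp FlowFamily.isCompact_bounded
  have : T2Space FlowFamily.bounded := inferInstanceAs (T2Space {x // x ∈ FlowFamily.bounded})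
  have : SecondCountableTopology FlowFamily.bounded :=
    Topology.IsEmbedding.subtypeVal.secondCountableTopology
  have : Nonempty FlowFamily.bounded := FlowFamily.bounded_nonempty.to_subtype
  have : ContinuousConstSMul FreeTwo FlowFamily.bounded := ⟨fun f => Continuous.subtype_mk
    (continuous_pi fun n => continuous_pi fun s => continuous_pi fun v =>
      (FlowFamily.continuous_eval n s (v * f)).comp continuous_subtype_val) _⟩
  refine ⟨K × FlowFamily.bounded, inferInstance, inferInstance, inferInstance, inferInstance,
    inferInstance, inferInstance, inferInstance, ?_, ?_, fun y => y.2,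
    continuous_subtype_val.comp continuous_snd, fun y => y.2.2, fun _ _ => rfl⟩
  · intro f hf y hy
    exact hfree f hf y.1 (congrArg Prod.fst hy)
  · rintro ⟨k, u⟩ U hU ⟨⟨k', u'⟩, hku⟩
    obtain ⟨O₁, O₂, hO₁, hO₂, hk, hu, hsub⟩ := isOpen_prod_iff.mp hU k' u' hku
    obtain ⟨m, hmc, hme, hm⟩ := FlowFamily.exists_equivariant_mem hfree k O₂ hO₂ ⟨u', hu⟩
    -- Right multiplication on the profinite group commutes with the left action of `FreeTwo` and
    -- carries `k` to `k'`.
    refine ⟨fun y => (y.1 * (k⁻¹ * k'), m y),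
      (continuous_fst.mul continuous_const).prodMk hmc, fun f y => ?_, hsub ⟨?_, hm u⟩⟩
    · exact Prod.ext (mul_assoc (ι f) y.1 _) (hme f y)
    · have h : k * (k⁻¹ * k') = k' := mul_inv_cancel_left k k'
      change k * (k⁻¹ * k') ∈ O₁
      rwa [h]

theorem mainTheorem1 (G : Type u) [Group G] [Countable G] [Infinite G] :
    ∃ (X : Type u) (_ : TopologicalSpace X) (_ : MeasurableSpace X) (_ : BorelSpace X)
      (_ : MulAction G X) (_ : MulAction (G × FreeGroup (Fin 2)) X),
      -- the `G`-action is the restriction of the `(G × F₂)`-action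
      (∀ (g : G) (x : X), g • x = ((g, 1) : G × FreeGroup (Fin 2)) • x) ∧
      -- as a `G`-flow, `X` is free and minimal and has no characteristic measure
      IsFlow G X ∧ IsFreeAction G X ∧ MulAction.IsMinimal G X ∧
      (¬ ∃ μ : Measure X, IsCharacteristicMeasure G μ) ∧
      -- as a `(G × F₂)`-flow, `X` is free and has no `F₂`-invariant probability measure
      IsFlow (G × FreeGroup (Fin 2)) X ∧ IsFreeAction (G × FreeGroup (Fin 2)) X ∧
      ¬ ∃ μ : Measure X, IsProbabilityMeasure μ ∧ ∀ h : FreeGroup (Fin 2),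
        μ.map (fun x => ((1, h) : G × FreeGroup (Fin 2)) • x) = μ := by
  obtain ⟨Z, _, _, _, _, _, _, _, _, hZfree, _⟩ := exists_free_minimal_zero_dimensional G
  obtain ⟨Y, _, _, _, _, _, _, _, hYfree, hY, θ, hθc, hθb, hθ⟩ := exists_freeTwo_flow
  obtain ⟨X, hXc, hXne, hXmin⟩ := exists_subMulAction_minimal_of_endomorphisms
    (Γ := G × FreeTwo) (Ω := SkewSpace G Z Y) (Set.range fun g => (g, 1)) (fun U hU hne => by
      obtain ⟨φ, h1, h2, h3⟩ := SkewSpace.exists_equivariant_forall_exists_smul_mem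
        hZfree hY U hU hne
      exact ⟨φ, h1, h2, fun x => (h3 x).elim fun g hg => ⟨_, ⟨g, rfl⟩, hg⟩⟩)
  have hcompact : CompactSpace X := isCompact_iff_compactSpace.mp hXc.isCompact
  have hT2 : T2Space X := inferInstanceAs (T2Space {x // x ∈ X})
  have hsc : SecondCountableTopology X := Topology.IsEmbedding.subtypeVal.secondCountableTopology
  have hmetr : TopologicalSpace.MetrizableSpace X :=
    TopologicalSpace.metrizableSpace_of_t3_secondCountable X
  have hne : Nonempty X := hXne.to_subtype
  have hcont : ContinuousConstSMul (G × FreeTwo) X := ⟨fun γ => Continuous.subtype_mk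
    ((continuous_const_smul γ).comp continuous_subtype_val) _⟩
  have hfree : IsFreeAction (G × FreeTwo) X := fun γ hγ x hx =>
    SkewSpace.isFreeAction hZfree hYfree γ hγ x.1 (congrArg Subtype.val hx)
  let mX : MeasurableSpace X := borel X
  have hB : BorelSpace X := ⟨rfl⟩
  let aX : MulAction G X := MulAction.compHom X (MonoidHom.inl G FreeTwo)
  have hres : ∀ (g : G) (x : X), g • x = ((g, 1) : G × FreeTwo) • x := fun _ _ => rfl
  have hnoinv : ¬ ∃ μ : Measure X, IsProbabilityMeasure μ ∧ ∀ h : FreeTwo,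
      μ.map (fun x => ((1, h) : G × FreeTwo) • x) = μ := by
    rintro ⟨μ, hμ, hinv⟩
    -- Evaluating the `Y`-valued function at `1` is an `F₂`-map to `Y`, and `θ` continues it to
    -- `FlowFamily`.
    refine FlowFamily.not_map_eq_of_equivariant μ (fun h x => ((1, h) : G × FreeTwo) • x)
      (fun h => continuous_const_smul _) (fun x => θ (x.1.2 1))
      (hθc.comp ((continuous_apply 1).comp (continuous_snd.comp continuous_subtype_val)))
      (fun x => hθb _) (fun h x => ?_) hinv
    rw [← hθ, SubMulAction.val_smul, SkewSpace.smul_snd]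
    simp only [mul_one]
  refine ⟨X, inferInstance, mX, hB, aX, inferInstance, hres,
    ⟨hne, hcompact, hmetr, fun g => continuous_const_smul ((g, 1) : G × FreeTwo)⟩,
    fun g hg => hfree (g, 1) fun h => hg (congrArg Prod.fst h), ⟨fun x => ?_⟩, ?_,
    ⟨hne, hcompact, hmetr, fun γ => continuous_const_smul γ⟩, hfree, hnoinv⟩
  · rw [dense_iff_inter_open]
    rintro _ hV ⟨y, hy⟩
    obtain ⟨V, hVo, rfl⟩ := isOpen_induced_iff.mp hV
    obtain ⟨_, ⟨g, rfl⟩, hg⟩ := hXmin x x.2 V hVo ⟨y, hy, y.2⟩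
    exact ⟨g • x, hg, g, rfl⟩
  · rintro ⟨μ, hμ, hinv⟩
    refine hnoinv ⟨μ, hμ, fun h => ?_⟩
    exact hinv (Homeomorph.smul ((1, h) : G × FreeTwo)) fun g x => by
      change ((1, h) : G × FreeTwo) • ((g, 1) : G × FreeTwo) • x =
        ((g, 1) : G × FreeTwo) • ((1, h) : G × FreeTwo) • x
      rw [smul_smul, smul_smul]
      simp
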